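/- Let $k$ be a field and let $G$ be a polycyclic-by-finite group, that is, a group with a finite series of subgroups $1=H_0\subseteq H_1\subseteq\cdots\subseteq H_n=G$ such that each $H_i$ is normal in $H_{i+1}$ and each factor $H_{i+1}/H_i$ is cyclic or finite. Let $\Delta(G)=\{g\in G : |G:\operatorname{Cent}_G(g)|<\infty\}$ be the FC-subgroup of $G$. If $k$ has characteristic $p>0$, assume in addition that $\Delta(G)$ contains no elements of order $p$. Then the group algebra $kG$ is residually simple artinian, that is, its two-sided ideals with simple artinian factor ring intersect in zero; more precisely, $$0=\bigcap\{P : P\triangleleft kG,\ P \text{ a maximal two-sided ideal},\ \dim_k(kG/P)<\infty\}.$$ -/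

import Mathlib

/-- `G` has a finite series `1 = H 0 ≤ H 1 ≤ ⋯ ≤ H n = G` of subgroups, each normal in the next,
in which every subfactor `H (i + 1) / H i` is cyclic or finite. -/
def IsPolycyclicByFinite (G : Type*) [Group G] : Prop :=
  ∃ (n : ℕ) (H : ℕ → Subgroup G), H 0 = ⊥ ∧ H n = ⊤ ∧
    ∀ i < n, H i ≤ H (i + 1) ∧
      ∃ _ : ((H i).subgroupOf (H (i + 1))).Normal,
        IsCyclic (H (i + 1) ⧸ (H i).subgroupOf (H (i + 1))) ∨
          Finite (H (i + 1) ⧸ (H i).subgroupOf (H (i + 1)))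

/-- The FC-subgroup `Δ(G)`: the elements whose centraliser has finite index in `G`, that is,
the elements with only finitely many conjugates. -/
def fcSubgroup (G : Type*) [Group G] : Subgroup G where
  carrier := {g | (Subgroup.centralizer {g}).FiniteIndex}
  one_mem' := by
    have h : Subgroup.centralizer {(1 : G)} = ⊤ := by
      ext x; simp [Subgroup.mem_centralizer_iff]
    simp only [Set.mem_ofPred_eq, h]
    infer_instance
  mul_mem' := by
    intro a b ha hb
    simp only [Set.mem_ofPred_eq] at ha hb ⊢
    refine Subgroup.finiteIndex_of_le (H := Subgroup.centralizer {a} ⊓ Subgroup.centralizer {b}) ?_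
    intro x hx
    simp only [Subgroup.mem_inf, Subgroup.mem_centralizer_singleton_iff] at hx ⊢
    exact Commute.mul_right hx.1 hx.2
  inv_mem' := by
    intro a ha
    simp only [Set.mem_ofPred_eq] at ha ⊢
    refine Subgroup.finiteIndex_of_le (H := Subgroup.centralizer {a}) ?_
    intro x hx
    simp only [Subgroup.mem_centralizer_singleton_iff] at hx ⊢
    exact Commute.inv_right hx

/-- A ring is residually simple artinian if its two-sided ideals with simple artinian factor ring
intersect in zero. -/
def IsResiduallySimpleArtinian (R : Type*) [Ring R] : Prop :=
  sInf {P : TwoSidedIdeal R |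
    IsSimpleRing P.ringCon.Quotient ∧ IsArtinianRing P.ringCon.Quotient} = ⊥

/-!
# Group algebras of polycyclic-by-finite groups are residually simple artinian

Let `b` lie in every two-sided ideal of `k[G]` whose quotient is simple of finite dimension. For each
normal subgroup `M` of finite index, the image of `b` in the finite-dimensional algebra `k[G / M]`
lies in the Jacobson radical, by the Wedderburn–Artin theorem (`map_mem_jacobson_of_forall_mem`).
The question is how to conclude that `b = 0` although these radicals need not vanish.

*A uniform bound.* If `M ≤ N` are normal in `G` of finite index and `[N : M]` is invertible in `k`,
then the radical of `k[G / M]` is nilpotent of index at most `[G : N]`, whatever `M` is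
(`jacobson_pow_index_eq_bot`): by Maschke's theorem `k[N / M]` is a sum of simple left ideals `W`,
and the left ideal of `k[G / M]` generated by `W` has length at most `[G : N]` over `k[N / M]`.

*Enough quotients.* For each prime `q`, the group `G` has a normal subgroup `N` of finite index and a
descending chain of subgroups `M n ≤ N` with trivial intersection, each normal in `G` and of
`q`-power index in `N` (`IsPolycyclicByFinite.exists_residual_chain`). This is obtained by working
with the powers of the augmentation ideal `ω` of `𝔽_q[N]` and the dimension subgroups
`{g | g - 1 ∈ ωⁿ}`. The inductive step along the polycyclic series concerns an extension of `A` by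
an infinite cyclic group. Some power `y` of the generator acts trivially on the finite ring
`𝔽_q[A] / ω²`, hence on all `ωⁱ / ωⁱ⁺¹`, so that `A ⋊ ⟨y⟩` acts on `𝔽_q[A]` unipotently with respect
to the filtration by the `ωⁱ` (`HasTrivialDimensionSubgroup.semidirectProduct`).

*Semiprimeness.* In characteristic `p`, take `q ≠ p`. The two facts above show that the ideal of all
such `b` is nilpotent, so it remains to see that `k[G]` is semiprime when the FC-subgroup `Δ(G)` has
no element of order `p` (`eq_zero_of_forall_mul_mul_eq_zero`). If `a k[G] a = 0`, then the
restriction of `a` to `Δ(G)` has square zero, by B. H. Neumann's lemma on coverings by cosets; and the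
coefficient at `1` of a nilpotent element supported on elements not of order `p` is zero, since the
coefficient at `1` of its `p`-th power is the `p`-th power of its coefficient at `1`.

In characteristic zero, `N = G` is allowed in the bound, all `k[G / M]` are semisimple, and `b` maps
to zero in each of them.
-/

/-! ### The coefficient at the identity of a nilpotent element -/

/-- In characteristic `p`, the sum of a function invariant under a permutation `σ` with `σ ^ p = 1`
is its sum over the fixed points of `σ`. -/
theorem sum_eq_sum_fixedPoints {k X : Type*} [Field k] (p : ℕ) [Fact p.Prime] [CharP k p]
    [Fintype X] [DecidableEq X] (σ : Equiv.Perm X) (hσ : σ ^ p = 1) (F : X → k)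
    (hF : ∀ x, F (σ x) = F x) : ∑ x, F x = ∑ x with σ x = x, F x := by
  classical
  have key : ∀ c : k, ((Finset.univ.filter fun x => F x = c).card : k)
      = (Finset.univ.filter fun x => σ x = x ∧ F x = c).card := by
    intro c
    let τ : Equiv.Perm {x // F x = c} := σ.subtypePerm fun x => by rw [hF]
    have hτ : τ ^ p ^ 1 = 1 := by
      rw [pow_one]
      ext x
      have : (τ ^ p) x = (σ ^ p) x := by simp [τ, Equiv.Perm.subtypePerm_pow]
      rw [this, hσ]; rfl
    have h := Equiv.Perm.card_compl_support_modEq hτ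
    rw [← CharP.natCast_eq_natCast (R := k), Fintype.card_subtype] at h
    rw [← h]
    congr 1
    refine Finset.card_bij (fun x _ => x.1) ?_ ?_ ?_
    · intro x hx
      have : τ x = x := by simpa using hx
      simpa [x.2, τ] using congrArg Subtype.val this
    · intro x _ y _ h
      exact Subtype.ext h
    · intro x hx
      simp only [Finset.mem_filter, Finset.mem_univ, true_and] at hx
      exact ⟨⟨x, hx.2⟩, by simp [τ, hx.1], rfl⟩
  rw [← Finset.sum_fiberwise_of_maps_to (t := Finset.univ.image F) (g := F)
      (fun x _ => Finset.mem_image_of_mem _ (Finset.mem_univ x)),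
    ← Finset.sum_fiberwise_of_maps_to (s := Finset.univ.filter fun x => σ x = x)
      (t := Finset.univ.image F) (g := F)
      (fun x _ => Finset.mem_image_of_mem _ (Finset.mem_univ x))]
  refine Finset.sum_congr rfl fun c _ => ?_
  rw [Finset.sum_congr rfl (g := fun _ => c) (by simp),
    Finset.sum_congr (s₂ := (Finset.univ.filter fun x => σ x = x).filter fun x => F x = c) rfl
      (g := fun _ => c) (by simp)]
  rw [Finset.sum_const, Finset.sum_const, nsmul_eq_mul, nsmul_eq_mul, key, Finset.filter_filter]

namespace MonoidAlgebra

theorem pow_eq_sum_single {k G : Type*} [CommSemiring k] [Monoid G] (a : MonoidAlgebra k G)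
    (n : ℕ) : a ^ n = ∑ f : Fin n → a.coeff.support,
      single (List.ofFn fun i => (f i : G)).prod (∏ i, a.coeff (f i)) := by
  classical
  induction n with
  | zero => simp [one_def]
  | succ n ih =>
    have ha : a = ∑ g : a.coeff.support, single (g : G) (a.coeff g) := by
      conv_lhs => rw [← sum_coeff_single a]
      rw [Finsupp.sum, ← Finset.sum_coe_sort]
    rw [pow_succ', ih]
    conv_lhs => enter [1]; rw [ha]
    rw [Finset.sum_mul_sum, ← Finset.sum_product', Finset.univ_product_univ]
    refine Fintype.sum_equiv (Fin.consEquiv fun _ => a.coeff.support) _ _ fun x => ?_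
    simp [single_mul_single, Fin.prod_univ_succ, List.ofFn_succ, Fin.consEquiv]

open Fin.NatCast Fin.CommRing in
/-- In characteristic `p`, the coefficient at `1` of `a ^ p` is the `p`-th power of the one of `a`:
the products `g₁ ⋯ gₚ` with non-constant `(g₁, …, gₚ)` cancel in orbits of cyclic rotation, and
the constant ones contribute only when `g ^ p = 1`. -/
theorem coeff_one_pow_char {k G : Type*} [Field k] [Group G] (p : ℕ) [hp : Fact p.Prime]
    [CharP k p] (a : MonoidAlgebra k G) (ha : ∀ g ∈ a.coeff.support, g ^ p = 1 → g = 1) :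
    (a ^ p).coeff 1 = a.coeff 1 ^ p := by
  classical
  obtain ⟨n, rfl⟩ : ∃ n, p = n + 1 := ⟨p - 1, by have := hp.out.pos; omega⟩
  let σ : Equiv.Perm (Fin (n + 1) → a.coeff.support) :=
    (Equiv.addRight (1 : Fin (n + 1))).symm.arrowCongr (Equiv.refl _)
  have hσ : ∀ f i, σ f i = f (i + 1) := fun f i => rfl
  have hσk : ∀ (m : ℕ) f i, (σ ^ m) f i = f (i + m) := by
    intro m
    induction m with
    | zero => simp
    | succ m ih =>
      intro f i
      rw [pow_succ', Equiv.Perm.mul_apply, hσ, ih]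
      congr 1; push_cast; ring
  rw [pow_eq_sum_single]
  simp only [coeff_sum, coeff_single, Finsupp.finsetSum_apply]
  rw [sum_eq_sum_fixedPoints (n + 1) σ]
  · have hfix : ∀ f : Fin (n + 1) → a.coeff.support, σ f = f → ∀ i, f i = f 0 := by
      intro f hf
      have hm : ∀ m : ℕ, (σ ^ m) f = f := by
        intro m
        induction m with
        | zero => simp
        | succ m ih => rw [pow_succ, Equiv.Perm.mul_apply, hf, ih]
      intro i
      have := congrFun (hm (i : ℕ)) 0
      rwa [hσk, zero_add, Fin.cast_val_eq_self] at this
    by_cases h1 : (1 : G) ∈ a.coeff.support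
    · rw [Finset.sum_eq_single_of_mem (fun _ => ⟨1, h1⟩) (by simp [funext_iff, hσ])]
      · simp
      · intro f hf hne
        have hf' := hfix f (by simpa using hf)
        have hf0 : f = fun _ => f 0 := funext hf'
        have hne' : (f 0 : G) ≠ 1 := fun h => hne (by rw [hf0]; ext; exact h)
        refine Finsupp.single_eq_of_ne' ?_
        rw [hf0, List.ofFn_const, List.prod_replicate]
        exact fun h => hne' (ha _ (f 0).2 h)
    · rw [Finsupp.notMem_support_iff.1 h1, zero_pow n.succ_ne_zero]
      refine Finset.sum_eq_zero fun f hf => ?_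
      have hf0 : f = fun _ => f 0 := funext (hfix f (by simpa using hf))
      refine Finsupp.single_eq_of_ne' ?_
      rw [hf0, List.ofFn_const, List.prod_replicate]
      exact fun h => h1 (ha _ (f 0).2 h ▸ (f 0).2)
  · ext f i
    rw [hσk]
    simp
  · intro f
    have hprod : ∏ i, a.coeff (σ f i) = ∏ i, a.coeff (f i) := by
      simp only [hσ]
      exact Fintype.prod_equiv (Equiv.addRight 1) _ _ fun i => rfl
    have hlist : (List.ofFn fun i => (f i : G)).prod = 1 ↔
        (List.ofFn fun i => (σ f i : G)).prod = 1 := by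
      rw [List.ofFn_succ, List.ofFn_succ', List.prod_cons, List.concat_eq_append, List.prod_append,
        List.prod_singleton]
      have h1 : (fun i : Fin n => (σ f i.castSucc : G)) = fun i => (f i.succ : G) := by
        ext i; rw [hσ, Fin.coeSucc_eq_succ]
      rw [h1, hσ, Fin.last_add_one]
      exact ⟨fun h => mul_eq_one_iff_inv_eq.1 h ▸ by simp, fun h => by
        rw [mul_eq_one_iff_eq_inv] at h; simp [h]⟩
    rw [hprod, Finsupp.single_apply, Finsupp.single_apply]
    simp only [hlist]

end MonoidAlgebra

/-! ### Semiprimeness of group algebras in characteristic `p` -/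

namespace MonoidAlgebra

variable {k G : Type*} [Field k] [Group G]

open Classical in
/-- The restriction of an element of `k[G]` to the FC-subgroup. -/
noncomputable def fcPart (a : MonoidAlgebra k G) : MonoidAlgebra k G :=
  ofCoeff (a.coeff.filter (· ∈ fcSubgroup G))

theorem fcPart_coeff_of_mem (a : MonoidAlgebra k G) {g : G} (hg : g ∈ fcSubgroup G) :
    (fcPart a).coeff g = a.coeff g := by
  classical exact Finsupp.filter_apply_pos _ _ hg

theorem fcPart_coeff_of_notMem (a : MonoidAlgebra k G) {g : G} (hg : g ∉ fcSubgroup G) :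
    (fcPart a).coeff g = 0 := by
  classical exact Finsupp.filter_apply_neg _ _ hg

theorem coeff_conj (a : MonoidAlgebra k G) (x g : G) :
    (single x 1 * a * single x⁻¹ 1).coeff g = a.coeff (x⁻¹ * g * x) := by
  simp [coeff_mul_single_apply, coeff_single_mul_apply, mul_assoc]

/-- If `a x b = 0` for all `x ∈ G`, then the FC-part `a₀` of `a` satisfies `a₀ b = 0`. Conjugating
by the `x` that centralise `a₀` gives `a₀ b = - (x (a - a₀) x⁻¹) b`; if this were non-zero, the
equations `x s x⁻¹ = v t⁻¹` with `s` in the support of `a - a₀` would cover a subgroup of finite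
index by cosets of centralisers of infinite index, against B. H. Neumann's lemma. -/
theorem fcPart_mul_eq_zero {a b : MonoidAlgebra k G} (h : ∀ x : G, a * single x 1 * b = 0) :
    fcPart a * b = 0 := by
  classical
  by_contra hne
  obtain ⟨v, hv⟩ : ∃ v, (fcPart a * b).coeff v ≠ 0 := by
    by_contra! hall
    exact hne (by ext v; simpa using hall v)
  let W : Subgroup G := ⨅ g : (fcPart a).coeff.support, Subgroup.centralizer {(g : G)}
  have hW : W.FiniteIndex := by
    refine Subgroup.finiteIndex_iInf fun g => ?_
    by_contra hg
    exact Finsupp.mem_support_iff.1 g.2 (fcPart_coeff_of_notMem a hg)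
  have hWa : ∀ x ∈ W, single x 1 * fcPart a = fcPart a * single x 1 := by
    intro x hx
    have : fcPart a = ∑ g ∈ (fcPart a).coeff.support, single g ((fcPart a).coeff g) :=
      (sum_coeff_single _).symm
    rw [this, Finset.mul_sum, Finset.sum_mul]
    refine Finset.sum_congr rfl fun g hg => ?_
    have hxg := Subgroup.mem_centralizer_singleton_iff.1 ((Subgroup.mem_iInf.1 hx) ⟨g, hg⟩)
    simp only [single_mul_single, one_mul, mul_one]
    rw [hxg]
  let c := a - fcPart a
  have hc : ∀ g ∈ c.coeff.support, g ∉ fcSubgroup G := by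
    intro g hg hgΔ
    refine Finsupp.mem_support_iff.1 hg ?_
    simp [c, fcPart_coeff_of_mem a hgΔ]
  have hsol : ∀ x ∈ W, ∃ s ∈ c.coeff.support, ∃ t ∈ b.coeff.support, x * s * x⁻¹ = v * t⁻¹ := by
    intro x hx
    have h0 : fcPart a * b = -(single x 1 * c * single x⁻¹ 1 * b) := by
      have h1 := h x⁻¹
      have h2 : single x 1 * fcPart a * single x⁻¹ 1 = fcPart a := by
        rw [hWa x hx, mul_assoc, single_mul_single]
        simp [← one_def]
      rw [eq_neg_iff_add_eq_zero, ← h2, ← add_mul, ← add_mul, ← mul_add, add_sub_cancel,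
        mul_assoc _ a, mul_assoc, h1, mul_zero]
    have h3 : v ∈ (single x 1 * c * single x⁻¹ 1 * b).coeff.support := by
      rw [Finsupp.mem_support_iff]
      intro h4
      exact hv (by rw [h0]; simpa using h4)
    obtain ⟨u, hu, t, ht, rfl⟩ := Finset.mem_mul.1 (support_coeff_mul_subset _ _ h3)
    rw [Finsupp.mem_support_iff, coeff_conj] at hu
    exact ⟨_, Finsupp.mem_support_iff.2 hu, t, ht, by group⟩
  have : Fintype (G ⧸ W) := Fintype.ofFinite _
  let x₀ : G × G → G := fun st => if h : ∃ x, x * st.1 * x⁻¹ = v * st.2⁻¹ then h.choose else 1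
  have hx₀ : ∀ s t x, x * s * x⁻¹ = v * t⁻¹ → x₀ (s, t) * s * (x₀ (s, t))⁻¹ = v * t⁻¹ := by
    intro s t x hx
    have hex : ∃ x, x * (s, t).1 * x⁻¹ = v * (s, t).2⁻¹ := ⟨x, hx⟩
    simp only [x₀, dif_pos hex]
    exact hex.choose_spec
  obtain ⟨⟨r, s, t⟩, hmem, hfin⟩ := Subgroup.exists_finiteIndex_of_leftCoset_cover
    (s := (Finset.univ : Finset (G ⧸ W)) ×ˢ (c.coeff.support ×ˢ b.coeff.support))
    (g := fun i => i.1.out * x₀ i.2) (H := fun i => Subgroup.centralizer {i.2.1}) (by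
      refine Set.eq_univ_of_forall fun g => ?_
      have hw : ((g : G ⧸ W).out)⁻¹ * g ∈ W := by
        rw [← QuotientGroup.eq]; exact Quotient.out_eq _
      obtain ⟨s, hs, t, ht, hst⟩ := hsol _ hw
      simp only [Set.mem_iUnion]
      refine ⟨((g : G ⧸ W), s, t), Finset.mem_product.2 ⟨Finset.mem_univ _, Finset.mem_product.2 ⟨hs, ht⟩⟩, ?_⟩
      have hx := hx₀ s t _ hst
      rw [Set.mem_smul_set_iff_inv_smul_mem, SetLike.mem_coe,
        Subgroup.mem_centralizer_singleton_iff]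
      rw [← hst] at hx
      generalize x₀ (s, t) = y at hx ⊢
      generalize ((g : G ⧸ W).out) = z at hx ⊢
      simp only [smul_eq_mul]
      have : s = y⁻¹ * (z⁻¹ * g * s * (z⁻¹ * g)⁻¹) * y := by rw [← hx]; group
      calc (z * y)⁻¹ * g * s = y⁻¹ * (z⁻¹ * g * s * (z⁻¹ * g)⁻¹) * y * ((z * y)⁻¹ * g) := by group
        _ = s * ((z * y)⁻¹ * g) := by rw [← this])
  simp only [Finset.mem_product] at hmem
  exact hc s hmem.2.1 hfin

/-- If `a x a = 0` for all `x ∈ G`, then the FC-part of `a` has square zero. -/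
theorem fcPart_mul_fcPart_eq_zero {a : MonoidAlgebra k G}
    (h : ∀ x : G, a * single x 1 * a = 0) : fcPart a * fcPart a = 0 := by
  classical
  have h0 := fcPart_mul_eq_zero h
  -- `a₀ * a₀` is supported on the FC-subgroup, and `a₀ * (a - a₀)` on its complement.
  have hmem : ∀ u ∈ (fcPart a).coeff.support, u ∈ fcSubgroup G := fun u hu => by
    by_contra hu'
    exact Finsupp.mem_support_iff.1 hu (fcPart_coeff_of_notMem a hu')
  ext v
  rw [coeff_zero, Finsupp.zero_apply]
  by_cases hv : v ∈ fcSubgroup G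
  · have h1 : (fcPart a * (a - fcPart a)).coeff v = 0 := by
      by_contra hne
      obtain ⟨u, hu, w, hw, rfl⟩ := Finset.mem_mul.1
        (support_coeff_mul_subset _ _ (Finsupp.mem_support_iff.2 hne))
      have hwΔ : w ∈ fcSubgroup G := (Subgroup.mul_mem_cancel_left _ (hmem u hu)).1 hv
      exact Finsupp.mem_support_iff.1 hw (by simp [fcPart_coeff_of_mem a hwΔ])
    rw [mul_sub, h0] at h1
    simpa using h1
  · by_contra hne
    obtain ⟨u, hu, w, hw, rfl⟩ := Finset.mem_mul.1
      (support_coeff_mul_subset _ _ (Finsupp.mem_support_iff.2 hne))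
    exact hv (mul_mem (hmem u hu) (hmem w hw))

/-- In characteristic `p`, the group algebra is semiprime if the FC-subgroup has no element of
order `p`. -/
theorem eq_zero_of_forall_mul_mul_eq_zero (p : ℕ) [hp : Fact p.Prime] [CharP k p]
    (hΔ : ∀ g ∈ fcSubgroup G, orderOf g ≠ p) {a : MonoidAlgebra k G}
    (h : ∀ x, a * x * a = 0) : a = 0 := by
  have key : ∀ b : MonoidAlgebra k G, (∀ x, b * x * b = 0) → b.coeff 1 = 0 := by
    intro b hb
    have h0 := fcPart_mul_fcPart_eq_zero fun x => hb (single x 1)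
    have h1 := coeff_one_pow_char p (fcPart b) fun g hg hgp => by
      by_contra hg1
      refine hΔ g ?_ (orderOf_eq_prime hgp hg1)
      by_contra hg'
      exact Finsupp.mem_support_iff.1 hg (fcPart_coeff_of_notMem b hg')
    rw [pow_eq_zero_of_le hp.out.two_le (by rw [sq, h0]), fcPart_coeff_of_mem b (one_mem _)] at h1
    exact pow_eq_zero_iff hp.out.ne_zero |>.1 (by simpa using h1.symm)
  ext g
  have := key (single g⁻¹ 1 * a) fun x => by
    rw [mul_assoc, mul_assoc, ← mul_assoc x, ← mul_assoc a, h, mul_zero]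
  simpa [coeff_single_mul_apply] using this

end MonoidAlgebra

/-! ### The radical over a normal subgroup of invertible order -/

theorem Module.length_biSup_le {A T ι : Type*} [Ring A] [AddCommGroup T] [Module A T]
    (Y : ι → Submodule A T) (hY : ∀ i, Module.length A (Y i) ≤ 1) (s : Finset ι) :
    Module.length A (⨆ i ∈ s, Y i : Submodule A T) ≤ s.card := by
  classical
  induction s using Finset.induction_on with
  | empty => rw [show (⨆ i ∈ (∅ : Finset ι), Y i) = ⊥ by simp, Module.length_bot]; simp
  | insert i s hi ih =>
    rw [Finset.iSup_insert, Finset.card_insert_of_notMem hi, Submodule.sup_eq_range]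
    calc _ ≤ Module.length A (Y i × (⨆ i ∈ s, Y i : Submodule A T)) :=
          Module.length_le_of_surjective _ (LinearMap.surjective_rangeRestrict _)
      _ ≤ _ := by
          rw [Module.length_prod, add_comm]
          push_cast
          exact add_le_add ih (hY i)

namespace MonoidAlgebra

variable {k H : Type*} [Field k] [Group H]

/-- Multiplication by group elements twists the elements of `k[L]`, for `L` normal. -/
theorem exists_mapDomain_mul_single (L : Subgroup H) [L.Normal] (h : H) (a : MonoidAlgebra k L) :
    ∃ a' : MonoidAlgebra k L, mapDomainAlgHom k k L.subtype a * single h 1 =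
      single h 1 * mapDomainAlgHom k k L.subtype a' := by
  induction a using induction_linear with
  | zero => exact ⟨0, by simp⟩
  | add x y hx hy =>
    obtain ⟨x', hx⟩ := hx
    obtain ⟨y', hy⟩ := hy
    exact ⟨x' + y', by rw [map_add, map_add, add_mul, mul_add, hx, hy]⟩
  | single l c =>
    refine ⟨single ⟨h⁻¹ * l * h, by simpa using ‹L.Normal›.conj_mem l l.2 h⁻¹⟩ c, ?_⟩
    simp [single_mul_single, mul_assoc]

/-- If `L` is a normal subgroup of the finite group `H` and `|L| ≠ 0` in `k`, then the `[H : L]`-th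
power of the Jacobson radical of `k[H]` vanishes. Indeed `k[L]` is a sum of simple left ideals `W`,
and each left ideal `k[H] W = ∑ h W` has length at most `[H : L]` over `k[L]`, so that
multiplying it by the radical leads to zero in at most `[H : L]` steps. -/
theorem jacobson_pow_index_eq_bot [Finite H] (L : Subgroup H) [L.Normal]
    (hL : (Nat.card L : k) ≠ 0) : Ring.jacobson (MonoidAlgebra k H) ^ L.index = ⊥ := by
  classical
  set T := MonoidAlgebra k H
  set A := MonoidAlgebra k L
  set J := Ring.jacobson T
  let φ : A →ₐ[k] T := mapDomainAlgHom k k L.subtype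
  have : NeZero (Nat.card L : k) := ⟨hL⟩
  let _ : Module A T := Module.compHom T φ.toRingHom
  have hsmul : ∀ (a : A) (t : T), a • t = φ a * t := fun _ _ => rfl
  have : IsScalarTower A T T := ⟨fun a t t' => by simp [hsmul, mul_assoc]⟩
  have : IsScalarTower k A T := ⟨fun c a t => by simp [hsmul]⟩
  have : Module.Finite k T := Module.Finite.equiv (coeffLinearEquiv k : T ≃ₗ[k] H →₀ k).symm
  have : IsArtinian A T := isArtinian_of_tower k inferInstance
  have : IsNoetherian A T := isNoetherian_of_tower k inferInstance
  have : IsArtinianRing T := isArtinian_of_tower k inferInstance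
  obtain ⟨N, hN⟩ : IsNilpotent J := IsSemiprimaryRing.isNilpotent
  -- The left ideal of `k[H]` generated by a simple left ideal of `k[L]` is short.
  have hlen : ∀ W : Submodule A A, IsSimpleModule A W →
      Module.length A ((Ideal.span (φ '' W)).restrictScalars A) ≤ L.index := by
    intro W hW
    let Y : H ⧸ L → Submodule A T := fun q =>
      { carrier := {t | ∃ w ∈ W, t = single q.out 1 * φ w}
        add_mem' := by
          rintro _ _ ⟨w, hw, rfl⟩ ⟨w', hw', rfl⟩
          exact ⟨w + w', add_mem hw hw', by rw [map_add, mul_add]⟩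
        zero_mem' := ⟨0, zero_mem _, by simp⟩
        smul_mem' := by
          rintro a _ ⟨w, hw, rfl⟩
          obtain ⟨a', ha'⟩ := exists_mapDomain_mul_single L q.out a
          refine ⟨a' * w, W.smul_mem a' hw, ?_⟩
          rw [hsmul, ← mul_assoc, map_mul, ← mul_assoc]
          exact congrArg (· * φ w) ha' }
    have hWatom := isSimpleModule_iff_isAtom.1 hW
    have hY1 : ∀ q, Module.length A (Y q) ≤ 1 := by
      intro q
      by_cases hbot : Y q = ⊥
      · rw [hbot]; simp
      have hat : IsAtom (Y q) := by
        refine ⟨hbot, fun Z hZ => ?_⟩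
        let Z' : Submodule A A :=
          { carrier := {w | w ∈ W ∧ single q.out 1 * φ w ∈ Z}
            add_mem' := by
              rintro a b ⟨ha, ha'⟩ ⟨hb, hb'⟩
              exact ⟨add_mem ha hb, by rw [map_add, mul_add]; exact add_mem ha' hb'⟩
            zero_mem' := ⟨zero_mem _, by simp⟩
            smul_mem' := by
              rintro a w ⟨hw, hw'⟩
              refine ⟨W.smul_mem a hw, ?_⟩
              obtain ⟨a', ha'⟩ := exists_mapDomain_mul_single L q.out⁻¹ a
              have h1 : single q.out 1 * φ a = φ a' * single q.out 1 := by
                have h2 : (single q.out 1 : T) * single q.out⁻¹ 1 = 1 := by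
                  simp [single_mul_single, one_def]
                have h3 : (single q.out⁻¹ 1 : T) * single q.out 1 = 1 := by
                  simp [single_mul_single, one_def]
                calc single q.out 1 * φ a
                    = single q.out 1 * (φ a * single q.out⁻¹ 1) * single q.out 1 := by
                      rw [mul_assoc, mul_assoc, h3, mul_one]
                  _ = φ a' * single q.out 1 := by
                      rw [show φ a * single q.out⁻¹ 1 = single q.out⁻¹ 1 * φ a' from ha',
                        ← mul_assoc, h2, one_mul]
              rw [smul_eq_mul, map_mul, ← mul_assoc, h1, mul_assoc]
              exact Z.smul_mem a' hw' }
        have hZW : Z' ≤ W := fun w hw => hw.1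
        rcases hZW.lt_or_eq with hlt | heq
        · rw [eq_bot_iff]
          intro z hz
          obtain ⟨w, hw, rfl⟩ := hZ.le hz
          have : w ∈ Z' := ⟨hw, hz⟩
          rw [hWatom.2 _ hlt, Submodule.mem_bot] at this
          simp [this]
        · refine absurd hZ.le (not_le_of_gt hZ |> fun h _ => h ?_)
          rintro _ ⟨w, hw, rfl⟩
          rw [← heq] at hw
          exact hw.2
      have := isSimpleModule_iff_isAtom.2 hat
      exact (Module.length_eq_one A (Y q)).le
    have : Fintype (H ⧸ L) := Fintype.ofFinite _
    have hmul : ∀ (t : T) (w : A), w ∈ W → t * φ w ∈ ⨆ q ∈ Finset.univ, Y q := by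
      intro t w hw
      induction t using induction_linear with
      | zero => simp
      | add x y hx hy => rw [add_mul]; exact add_mem hx hy
      | single h c =>
        have hl : (h : H ⧸ L).out⁻¹ * h ∈ L := by
          rw [← QuotientGroup.eq]; exact Quotient.out_eq _
        refine Submodule.mem_iSup_of_mem (h : H ⧸ L)
          (Submodule.mem_iSup_of_mem (Finset.mem_univ _) ?_)
        refine ⟨single ⟨_, hl⟩ c * w, W.smul_mem _ hw, ?_⟩
        rw [map_mul, ← mul_assoc]
        congr 1
        change _ = single _ 1 * mapDomainAlgHom k k L.subtype (single _ c)
        simp only [mapDomainAlgHom_apply, mapDomain_single]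
        have : (single h c : MonoidAlgebra k H) =
          single (h : H ⧸ L).out 1 * single ((h : H ⧸ L).out⁻¹ * h) c := by
          simp [single_mul_single]
        exact this
    have hle : (Ideal.span (φ '' W)).restrictScalars A ≤ ⨆ q ∈ Finset.univ, Y q := by
      intro x hx
      have : ∀ t : T, t * x ∈ ⨆ q ∈ Finset.univ, Y q := by
        rw [Submodule.restrictScalars_mem] at hx
        induction hx using Submodule.span_induction with
        | mem x hx =>
          obtain ⟨w, hw, rfl⟩ := hx
          exact fun t => hmul t w hw
        | zero => simp
        | add x y _ _ hx hy => exact fun t => by rw [mul_add]; exact add_mem (hx t) (hy t)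
        | smul s x _ hx => exact fun t => by rw [smul_eq_mul, ← mul_assoc]; exact hx _
      simpa using this 1
    calc _ ≤ Module.length A (⨆ q ∈ Finset.univ, Y q : Submodule A T) :=
          Module.length_le_of_injective (Submodule.inclusion hle) (Submodule.inclusion_injective hle)
      _ ≤ _ := Module.length_biSup_le Y hY1 _
      _ = _ := by rw [Finset.card_univ, Subgroup.index, Nat.card_eq_fintype_card]
  -- Multiplication by the radical strictly shortens a non-zero left ideal.
  have hstep : ∀ (X : Ideal T) (i : ℕ), J ^ i * X = ⊥ ∨
      Order.height ((J ^ i * X).restrictScalars A) + i ≤ Order.height (X.restrictScalars A) := by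
    intro X i
    induction i with
    | zero => right; rw [Submodule.pow_zero, Submodule.one_mul]; simp
    | succ i ih =>
      by_cases hbot : J ^ i * X = ⊥
      · left; rw [Ideal.IsTwoSided.pow_succ, Ideal.mul_assoc, hbot, Ideal.mul_bot]
      have ih := ih.resolve_left hbot
      right
      have hlt : (J ^ (i + 1) * X).restrictScalars A < (J ^ i * X).restrictScalars A := by
        have hle : J ^ (i + 1) * X ≤ J ^ i * X := by
          rw [Ideal.IsTwoSided.pow_succ, Ideal.mul_assoc]
          exact Ideal.mul_le.2 fun _ _ s hs => Ideal.mul_mem_left _ _ hs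
        refine lt_of_le_of_ne hle fun heq => hbot ?_
        have heq' : J * (J ^ i * X) = J ^ i * X := by
          rw [← Ideal.mul_assoc, ← Ideal.IsTwoSided.pow_succ (I := J)]
          exact Submodule.restrictScalars_injective A T T heq
        have : ∀ n, J ^ n * (J ^ i * X) = J ^ i * X := by
          intro n
          induction n with
          | zero => rw [Submodule.pow_zero, Submodule.one_mul]
          | succ n ihn => rw [Submodule.pow_succ, Ideal.mul_assoc, heq', ihn]
        rw [← this N, hN]
        simp
      have := Submodule.height_strictMono (R := A) hlt
      have := Order.add_one_le_of_lt this
      push_cast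
      calc _ = Order.height ((J ^ (i + 1) * X).restrictScalars A) + 1 + (i : ℕ∞) := by ring
        _ ≤ _ := (add_le_add this le_rfl).trans ih
  have hkill : ∀ W : Submodule A A, IsSimpleModule A W → J ^ L.index * Ideal.span (φ '' W) = ⊥ := by
    intro W hW
    rcases hstep (Ideal.span (φ '' W)) L.index with h | h
    · exact h
    have h1 := hlen W hW
    rw [Module.length_submodule] at h1
    have h2 := h.trans h1
    have h3 : Order.height ((J ^ L.index * Ideal.span (φ '' W)).restrictScalars A) = 0 := by
      have : (L.index : ℕ∞) ≠ ⊤ := ENat.natCast_ne_top _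
      exact (ENat.addLECancellable_of_ne_top this).add_le_iff_nonpos_left.1 h2 |> nonpos_iff_eq_zero.1
    rw [Order.height_eq_zero, isMin_iff_eq_bot] at h3
    exact (Submodule.restrictScalars_eq_bot_iff ..).1 h3
  -- Hence the left ideal of all `a` killed by `J ^ [H : L]` contains every simple left ideal.
  let Z : Submodule A A :=
    { carrier := {a | ∀ j ∈ J ^ L.index, j * φ a = 0}
      add_mem' := fun ha hb j hj => by rw [map_add, mul_add, ha j hj, hb j hj, add_zero]
      zero_mem' := by simp
      smul_mem' := fun c a ha j hj => by
        rw [smul_eq_mul, map_mul, ← mul_assoc]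
        exact ha _ (Ideal.mul_mem_right _ _ hj) }
  have hZ : Z = ⊤ := by
    rw [eq_top_iff, ← IsSemisimpleModule.sSup_simples_eq_top A A]
    refine sSup_le fun W hW w hw j hj => ?_
    have := Ideal.mul_mem_mul hj (Ideal.subset_span (Set.mem_image_of_mem φ hw))
    rwa [hkill W hW, Ideal.mem_bot] at this
  rw [eq_bot_iff]
  intro j hj
  have h1 : (1 : A) ∈ Z := hZ ▸ Submodule.mem_top
  simpa using h1 j hj

end MonoidAlgebra

/-! ### Maximal ideals of finite codimension and the Jacobson radical -/

theorem TwoSidedIdeal.isCoatom_of_isSimpleRing_quotient {R : Type*} [Ring R] (P : TwoSidedIdeal R)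
    [h : IsSimpleRing P.ringCon.Quotient] : IsCoatom P := by
  rw [← OrderIso.isCoatom_iff TwoSidedIdeal.orderIsoRingCon, ← Set.isSimpleOrder_Ici_iff_isCoatom]
  have h1 : IsSimpleOrder (RingCon P.ringCon.Quotient) :=
    TwoSidedIdeal.orderIsoRingCon.symm.isSimpleOrder
  exact (RingCon.correspondence (c := P.ringCon)).isSimpleOrder

/-- The ideals with simple quotient of finite dimension cut out the Jacobson radical in every
quotient algebra of finite dimension, by the Wedderburn–Artin theorem. -/
theorem map_mem_jacobson_of_forall_mem {k R S : Type*} [Field k] [Ring R] [Algebra k R] [Ring S]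
    [Algebra k S] [Module.Finite k S] (π : R →ₐ[k] S) (hπ : Function.Surjective π) {b : R}
    (hb : ∀ P : TwoSidedIdeal R, IsSimpleRing P.ringCon.Quotient →
      FiniteDimensional k P.ringCon.Quotient → b ∈ P) : π b ∈ Ring.jacobson S := by
  have : IsArtinianRing S := isArtinian_of_tower k inferInstance
  let J := Ring.jacobson S
  let ρ : S →ₐ[k] S ⧸ J := Ideal.Quotient.mkₐ k J
  have hρ : Function.Surjective ρ := Ideal.Quotient.mkₐ_surjective k J
  have : Module.Finite k (S ⧸ J) := Module.Finite.of_surjective ρ.toLinearMap hρ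
  obtain ⟨n, D, d, _, _, hd, ⟨e⟩⟩ :=
    IsSemisimpleRing.exists_algEquiv_pi_matrix_divisionRing k (S ⧸ J)
  have h0 : e (ρ (π b)) = 0 := by
    ext1 i
    have := hd i
    let ev : ((i : Fin n) → Matrix (Fin (d i)) (Fin (d i)) (D i)) →ₐ[k] _ :=
      Pi.evalAlgHom k (fun i => Matrix (Fin (d i)) (Fin (d i)) (D i)) i
    let f : R →ₐ[k] Matrix (Fin (d i)) (Fin (d i)) (D i) :=
      ev.comp (e.toAlgHom.comp (ρ.comp π))
    have hf : Function.Surjective f :=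
      (Function.surjective_eval i).comp (e.surjective.comp (hρ.comp hπ))
    have hfin : Module.Finite k (Matrix (Fin (d i)) (Fin (d i)) (D i)) :=
      Module.Finite.of_surjective (ev.comp e.toAlgHom).toLinearMap
        ((Function.surjective_eval i).comp e.surjective)
    let P : TwoSidedIdeal R := TwoSidedIdeal.ker f
    have hP : P.ringCon = RingCon.ker f.toRingHom := rfl
    have hs : IsSimpleRing (RingCon.ker f.toRingHom).Quotient :=
      IsSimpleRing.of_ringEquiv (RingCon.quotientKerEquivOfSurjective f.toRingHom hf).symm
        inferInstance
    have hfd : FiniteDimensional k (RingCon.ker f.toRingHom).Quotient :=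
      Module.Finite.of_injective (RingCon.kerLiftₐ f).toLinearMap (RingCon.kerLiftₐ_injective f)
    exact (TwoSidedIdeal.mem_ker f).1 (hb P hs hfd)
  have h1 : ρ (π b) = 0 := by simpa using h0
  exact Ideal.Quotient.eq_zero_iff_mem.1 h1

/-! ### Powers of the augmentation ideal -/

namespace MonoidAlgebra

variable (k G : Type*) [Field k] [Group G]

/-- The augmentation map of `k[G]`, sending every group element to `1`. -/
noncomputable def augmentation : MonoidAlgebra k G →ₐ[k] k := lift k k G 1

/-- The augmentation ideal of `k[G]`. -/
noncomputable def augIdeal : Ideal (MonoidAlgebra k G) := RingHom.ker (augmentation k G)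

instance : (augIdeal k G).IsTwoSided := inferInstanceAs (RingHom.ker (augmentation k G)).IsTwoSided

variable {k G}

theorem single_sub_one_mem_augIdeal (g : G) : single g 1 - 1 ∈ augIdeal k G := by
  rw [augIdeal, RingHom.mem_ker, map_sub, map_one, augmentation, lift_single]
  simp

/-- The augmentation ideal is spanned over `k` by the elements `g - 1`. -/
theorem augIdeal_le {N : Submodule k (MonoidAlgebra k G)} (h : ∀ g : G, single g 1 - 1 ∈ N)
    {v : MonoidAlgebra k G} (hv : v ∈ augIdeal k G) : v ∈ N := by
  have key : ∀ u : MonoidAlgebra k G, u - augmentation k G u • 1 ∈ N := by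
    intro u
    induction u using induction_linear with
    | zero => simp
    | add x y hx hy =>
      rw [map_add, add_smul, add_sub_add_comm]
      exact add_mem hx hy
    | single g c =>
      have : (single g c : MonoidAlgebra k G) - augmentation k G (single g c) • 1 =
          c • (single g 1 - 1) := by
        rw [augmentation, lift_single, smul_sub, smul_single]
        simp
      rw [this]
      exact N.smul_mem _ (h g)
  have := key v
  rwa [show augmentation k G v = 0 from hv, zero_smul, sub_zero] at this

/-- An algebra homomorphism into a filtered ring that maps all `g - 1` into the first step of the filtration
maps the `n`-th power of the augmentation ideal into the `n`-th step. -/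
theorem map_mem_of_mem_augIdeal_pow {S : Type*} [Ring S] [Algebra k S]
    (f : MonoidAlgebra k G →ₐ[k] S) (F : ℕ → Submodule k S) (h0 : ∀ v, f v ∈ F 0)
    (hmul : ∀ n, ∀ x ∈ F 1, ∀ y ∈ F n, x * y ∈ F (n + 1))
    (h1 : ∀ g : G, f (single g 1 - 1) ∈ F 1) (n : ℕ) {v : MonoidAlgebra k G}
    (hv : v ∈ augIdeal k G ^ n) : f v ∈ F n := by
  induction n generalizing v with
  | zero => exact h0 _
  | succ n ih =>
    rw [Ideal.IsTwoSided.pow_succ] at hv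
    induction hv using Submodule.smul_induction_on' with
    | smul x hx y hy =>
      rw [smul_eq_mul, map_mul]
      exact hmul n _ (augIdeal_le (N := (F 1).comap f.toLinearMap) h1 hx) _ (ih hy)
    | add x _ y _ hx hy => rw [map_add]; exact add_mem hx hy

theorem mapDomain_mem_augIdeal_pow {H : Type*} [Group H] (φ : G →* H) (n : ℕ)
    {v : MonoidAlgebra k G} (hv : v ∈ augIdeal k G ^ n) :
    mapDomainAlgHom k k φ v ∈ augIdeal k H ^ n := by
  refine map_mem_of_mem_augIdeal_pow (mapDomainAlgHom k k φ)
    (fun n => (augIdeal k H ^ n).restrictScalars k) (fun x => ?_) (fun n x hx y hy => ?_)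
    (fun g => ?_) n hv
  · rw [Submodule.pow_zero, Ideal.one_eq_top]; trivial
  · rw [Submodule.restrictScalars_mem, Submodule.pow_one] at hx
    rw [Submodule.restrictScalars_mem, Ideal.IsTwoSided.pow_succ]
    exact Ideal.mul_mem_mul hx hy
  · rw [Submodule.restrictScalars_mem, Submodule.pow_one]
    rw [map_sub, map_one, mapDomainAlgHom_apply, mapDomain_single]
    exact single_sub_one_mem_augIdeal (φ g)

/-- For a finitely generated group, the powers of the augmentation ideal have finite codimension:
the augmentation ideal is generated as a left ideal by the `s - 1`, with `s` in a finite generating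
set, so that `k[G] = V + ωⁿ` implies `k[G] = k + ∑ V (s - 1) + ωⁿ⁺¹`. -/
theorem finite_quotient_augIdeal_pow [hG : Group.FG G] (n : ℕ) :
    Module.Finite k (MonoidAlgebra k G ⧸ augIdeal k G ^ n) := by
  classical
  obtain ⟨S, hS⟩ := Group.fg_def.1 hG
  suffices h : ∃ V : Submodule k (MonoidAlgebra k G), V.FG ∧
      ∀ u, ∃ v ∈ V, u - v ∈ augIdeal k G ^ n by
    obtain ⟨V, hV, h⟩ := h
    have := Module.Finite.iff_fg.2 hV
    refine Module.Finite.of_surjective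
      ((Ideal.Quotient.mkₐ k (augIdeal k G ^ n)).toLinearMap.comp V.subtype) fun x => ?_
    obtain ⟨u, rfl⟩ := Ideal.Quotient.mk_surjective x
    obtain ⟨v, hv, huv⟩ := h u
    exact ⟨⟨v, hv⟩, ((Ideal.Quotient.mk_eq_mk_iff_sub_mem _ _).2 huv).symm⟩
  induction n with
  | zero =>
    exact ⟨⊥, Submodule.fg_bot, fun u => ⟨0, zero_mem _, by
      rw [Submodule.pow_zero, Ideal.one_eq_top]; trivial⟩⟩
  | succ n ih =>
    obtain ⟨V, hV, h⟩ := ih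
    let r : G → MonoidAlgebra k G →ₗ[k] MonoidAlgebra k G :=
      fun s => LinearMap.mulRight k (single s 1 - 1)
    let V' : Submodule k (MonoidAlgebra k G) := Submodule.span k {1} ⊔ ⨆ s ∈ S, V.map (r s)
    refine ⟨V', (Submodule.fg_span (Set.finite_singleton _)).sup
      (Submodule.fg_biSup _ _ fun s _ => hV.map _), fun u => ?_⟩
    -- `E` collects the elements that are congruent to an element of `V'`.
    let E : Submodule k (MonoidAlgebra k G) := V' ⊔ (augIdeal k G ^ (n + 1)).restrictScalars k
    have hE : ∀ s ∈ S, ∀ u, u * (single s 1 - 1) ∈ E := by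
      intro s hs u
      obtain ⟨v, hv, huv⟩ := h u
      rw [← add_sub_cancel v u, add_mul]
      refine Submodule.add_mem_sup (Submodule.mem_sup_right
        (Submodule.mem_iSup_of_mem s (Submodule.mem_iSup_of_mem hs ⟨v, hv, rfl⟩))) ?_
      rw [Submodule.restrictScalars_mem, Submodule.pow_succ]
      exact Ideal.mul_mem_mul huv (single_sub_one_mem_augIdeal s)
    let U : Subgroup G :=
      { carrier := {g | ∀ u, u * (single g 1 - 1) ∈ E}
        one_mem' := fun u => by rw [← one_def, sub_self, mul_zero]; exact zero_mem _
        mul_mem' := fun {a b} ha hb u => by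
          have : u * (single (a * b) 1 - 1) =
              u * single a 1 * (single b 1 - 1) + u * (single a 1 - 1) := by
            rw [mul_sub, mul_sub, mul_sub, mul_assoc u, single_mul_single]
            simp
          rw [this]
          exact add_mem (hb _) (ha _)
        inv_mem' := fun {a} ha u => by
          have : u * (single a⁻¹ 1 - 1) = -(u * single a⁻¹ 1 * (single a 1 - 1)) := by
            rw [mul_sub, mul_sub, mul_assoc u, single_mul_single]
            simp [← one_def]
          rw [this]
          exact neg_mem (ha _) }
    have hU : U = ⊤ := by
      rw [eq_top_iff, ← hS, Subgroup.closure_le]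
      exact hE
    have huE : u ∈ E := by
      have h1 : u - augmentation k G u • 1 ∈ E := by
        refine augIdeal_le (fun g => ?_) (v := u - augmentation k G u • 1) ?_
        · have : g ∈ U := hU ▸ Subgroup.mem_top g
          simpa using this 1
        · rw [augIdeal, RingHom.mem_ker]
          simp
      rw [← sub_add_cancel u (augmentation k G u • 1)]
      exact add_mem h1 (E.smul_mem _ (Submodule.mem_sup_left
        (Submodule.mem_sup_left (Submodule.subset_span rfl))))
    obtain ⟨v, hv, w, hw, rfl⟩ := Submodule.mem_sup.1 huE
    exact ⟨v, hv, by simpa using hw⟩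

end MonoidAlgebra

/-! ### Groups on which the powers of the augmentation ideal intersect trivially -/

namespace MonoidAlgebra

variable (k : Type*) [Field k]

/-- `G` has trivial intersection of its dimension subgroups `{g | g - 1 ∈ ωⁿ}` over `k`, where `ω`
is the augmentation ideal of `k[G]`. For a finitely generated group over `𝔽_q` this says that the
group is residually a finite `q`-group. -/
def HasTrivialDimensionSubgroup (G : Type*) [Group G] : Prop :=
  ∀ g : G, g ≠ 1 → ∃ n, single g 1 - 1 ∉ augIdeal k G ^ n

variable {k}

theorem HasTrivialDimensionSubgroup.of_injective {G H : Type*} [Group G] [Group H]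
    (hH : HasTrivialDimensionSubgroup k H) (φ : G →* H) (hφ : Function.Injective φ) :
    HasTrivialDimensionSubgroup k G := by
  intro g hg
  obtain ⟨n, hn⟩ := hH (φ g) fun h => hg (hφ (by rw [h, map_one]))
  refine ⟨n, fun h => hn ?_⟩
  have := mapDomain_mem_augIdeal_pow φ n h
  rwa [map_sub, map_one, mapDomainAlgHom_apply, mapDomain_single] at this

/-- The Magnus embedding `t ↦ 1 + X` of the infinite cyclic group into power series. -/
theorem hasTrivialDimensionSubgroup_int :
    HasTrivialDimensionSubgroup k (Multiplicative ℤ) := by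
  have hu : IsUnit (1 + PowerSeries.X : PowerSeries k) := by
    rw [PowerSeries.isUnit_iff_constantCoeff]
    simp
  obtain ⟨u, hu⟩ := hu
  let f : MonoidAlgebra k (Multiplicative ℤ) →ₐ[k] PowerSeries k :=
    lift k _ _ ((Units.coeHom _).comp (zpowersHom _ u))
  have hf : ∀ s : Multiplicative ℤ, f (single s 1) = ((u ^ s.toAdd : (PowerSeries k)ˣ) :) := by
    intro s
    simp [f, lift_single]
  intro s hs
  have hs' : s.toAdd ≠ 0 := hs
  have hne : f (single s 1 - 1) ≠ 0 := by
    rw [map_sub, map_one, hf, sub_ne_zero]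
    intro h
    have h1 : u ^ s.toAdd = 1 := Units.ext h
    have h2 : u ^ s.toAdd.natAbs = 1 := pow_natAbs_eq_one.2 h1
    have h3 : (1 + Polynomial.X : Polynomial k) ^ s.toAdd.natAbs = 1 := by
      apply Polynomial.coe_injective
      have := congrArg Units.val h2
      rw [Units.val_pow_eq_pow_val, hu] at this
      simpa using this
    have h4 := congrArg Polynomial.natDegree h3
    rw [Polynomial.natDegree_pow, add_comm, ← Polynomial.C_1, Polynomial.natDegree_X_add_C,
      Polynomial.natDegree_C] at h4
    omega
  obtain ⟨m, hm⟩ : ∃ m, PowerSeries.coeff m (f (single s 1 - 1)) ≠ 0 := by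
    by_contra! h
    exact hne (PowerSeries.ext (by simpa using h))
  refine ⟨m + 1, fun h => hm ?_⟩
  have := map_mem_of_mem_augIdeal_pow f
    (fun n => (Ideal.span {(PowerSeries.X : PowerSeries k) ^ n}).restrictScalars k)
    (fun x => by simp) (fun n x hx y hy => ?_) (fun g => ?_) (m + 1) h
  · rw [Submodule.restrictScalars_mem, Ideal.mem_span_singleton, PowerSeries.X_pow_dvd_iff] at this
    exact this m (Nat.lt_succ_self m)
  · rw [Submodule.restrictScalars_mem, Ideal.mem_span_singleton] at hx hy ⊢
    rw [add_comm n, pow_add]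
    exact mul_dvd_mul hx hy
  · rw [Submodule.restrictScalars_mem, Ideal.mem_span_singleton, pow_one, PowerSeries.X_dvd_iff,
      map_sub, map_one, hf, map_sub, map_one, sub_eq_zero]
    have h1 : Units.map (PowerSeries.constantCoeff (R := k)).toMonoidHom u = 1 := by
      ext
      simp [hu]
    have h2 := congrArg Units.val
      (map_zpow (Units.map (PowerSeries.constantCoeff (R := k)).toMonoidHom) u g.toAdd)
    rw [h1, one_zpow] at h2
    exact h2

/-- The action of the automorphisms of `A` on the group algebra `k[A]`. -/
noncomputable def mapAut (k : Type*) {A : Type*} [Field k] [Group A] :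
    MulAut A →* (MonoidAlgebra k A ≃ₐ[k] MonoidAlgebra k A) := domCongrAut

theorem mapAut_single {A : Type*} [Group A] (σ : MulAut A) (a : A) (c : k) :
    mapAut k σ (single a c) = single (σ a) c := domCongr_single σ a c

/-- The automorphisms of `A` that act trivially on `k[A] / ω²`. -/
noncomputable def unipotentAut (k A : Type*) [Field k] [Group A] : Subgroup (MulAut A) where
  carrier := {σ | ∀ v, mapAut k σ v - v ∈ augIdeal k A ^ 2}
  one_mem' := fun v => by simp
  mul_mem' := fun {σ τ} hσ hτ v => by
    rw [map_mul, AlgEquiv.mul_apply, ← sub_add_sub_cancel]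
    exact add_mem (hσ _) (hτ v)
  inv_mem' := fun {σ} hσ v => by
    have h1 := hσ (mapAut k σ⁻¹ v)
    rw [← AlgEquiv.mul_apply, ← map_mul, mul_inv_cancel, map_one, AlgEquiv.one_apply] at h1
    rw [← neg_sub]
    exact neg_mem h1

theorem mapAut_mem_augIdeal_pow {A : Type*} [Group A] (σ : MulAut A) {n : ℕ}
    {v : MonoidAlgebra k A} (hv : v ∈ augIdeal k A ^ n) :
    mapAut k σ v ∈ augIdeal k A ^ n :=
  mapDomain_mem_augIdeal_pow σ.toMonoidHom n hv

/-- An automorphism that is trivial modulo `ω²` acts trivially on each `ωⁱ / ωⁱ⁺¹`. -/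
theorem mapAut_sub_mem {A : Type*} [Group A] {σ : MulAut A} (hσ : σ ∈ unipotentAut k A) (i : ℕ)
    {v : MonoidAlgebra k A} (hv : v ∈ augIdeal k A ^ i) :
    mapAut k σ v - v ∈ augIdeal k A ^ (i + 1) := by
  induction i generalizing v with
  | zero => exact Ideal.pow_le_pow_right (by norm_num) (hσ v)
  | succ i ih =>
    rw [Ideal.IsTwoSided.pow_succ] at hv
    induction hv using Submodule.smul_induction_on' with
    | smul x hx y hy =>
      have h1 := Ideal.mul_mem_mul (hσ x) (mapAut_mem_augIdeal_pow σ hy)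
      have h2 := Ideal.mul_mem_mul hx (ih hy)
      rw [← Ideal.IsTwoSided.pow_add, show 2 + i = i + 1 + 1 by ring] at h1
      rw [← Ideal.IsTwoSided.pow_succ] at h2
      have : mapAut k σ (x • y) - x • y =
          (mapAut k σ x - x) * mapAut k σ y + x * (mapAut k σ y - y) := by
        rw [smul_eq_mul, map_mul]; noncomm_ring
      rw [this]
      exact add_mem h1 h2
    | add x _ y _ hx hy =>
      rw [map_add, add_sub_add_comm]
      exact add_mem hx hy

/-- A semidirect product inherits triviality of the intersection of its dimension subgroups if the
action is trivial modulo `ω²`: then `A ⋊ C` acts on `k[A]`, with `A` acting by multiplication, in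
such a way that its augmentation ideal raises the filtration by the powers of `ω`. -/
theorem HasTrivialDimensionSubgroup.semidirectProduct {A C : Type*} [Group A] [Group C]
    (hA : HasTrivialDimensionSubgroup k A) (hC : HasTrivialDimensionSubgroup k C)
    (φ : C →* MulAut A) (hφ : ∀ c, φ c ∈ unipotentAut k A) :
    HasTrivialDimensionSubgroup k (A ⋊[φ] C) := by
  intro g hg
  by_cases hr : g.right = 1
  swap
  · obtain ⟨n, hn⟩ := hC g.right hr
    refine ⟨n, fun h => hn ?_⟩
    have := mapDomain_mem_augIdeal_pow (SemidirectProduct.rightHom (φ := φ)) n h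
    rwa [map_sub, map_one, mapDomainAlgHom_apply, mapDomain_single] at this
  have hl : g.left ≠ 1 := fun h => hg (SemidirectProduct.ext h hr)
  obtain ⟨n, hn⟩ := hA g.left hl
  refine ⟨n, fun h => hn ?_⟩
  let act : A ⋊[φ] C →* Module.End k (MonoidAlgebra k A) :=
    { toFun := fun g =>
        (LinearMap.mulLeft k (single g.left 1)).comp (mapAut k (φ g.right)).toLinearMap
      map_one' := by ext; simp [← one_def]
      map_mul' := fun g h => by
        refine LinearMap.ext fun v => ?_
        simp only [SemidirectProduct.mul_left, SemidirectProduct.mul_right, map_mul,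
          LinearMap.comp_apply, LinearMap.mulLeft_apply, Module.End.mul_apply,
          AlgEquiv.toLinearMap_apply, AlgEquiv.mul_apply]
        rw [← mul_assoc]
        congr 1
        simp [single_mul_single, mapAut_single] }
  have hact : ∀ g v, act g v = single g.left 1 * mapAut k (φ g.right) v := fun _ _ => rfl
  let F : ℕ → Submodule k (Module.End k (MonoidAlgebra k A)) := fun n =>
    { carrier := {f | ∀ i, ∀ u ∈ augIdeal k A ^ i, f u ∈ augIdeal k A ^ (i + n)}
      add_mem' := fun hf hg i u hu => add_mem (hf i u hu) (hg i u hu)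
      zero_mem' := fun i u _ => zero_mem _
      smul_mem' := fun c f hf i u hu =>
        ((augIdeal k A ^ (i + n)).restrictScalars k).smul_mem c (hf i u hu) }
  have hlift : ∀ g, lift k _ _ act (single g 1 - 1) = act g - 1 := fun g => by
    rw [map_sub, map_one, lift_single, one_smul]
  have hF := map_mem_of_mem_augIdeal_pow (lift k _ _ act) F (fun v => ?_)
    (fun n f hf f' hf' i u hu => ?_) (fun g i u hu => ?_) n h
  · have h1 := hF 0 1 (by rw [Submodule.pow_zero, Ideal.one_eq_top]; trivial)
    rw [hlift, LinearMap.sub_apply, hact, hr, map_one, Module.End.one_apply, mul_one,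
      zero_add] at h1
    exact h1
  · induction v using induction_linear with
    | zero => rw [map_zero]; exact zero_mem _
    | add x y hx hy => rw [map_add]; exact add_mem hx hy
    | single g c =>
      rw [lift_single]
      exact (F 0).smul_mem c fun i u hu =>
        Ideal.mul_mem_left _ _ (mapAut_mem_augIdeal_pow _ hu)
  · have h1 := hf _ _ (hf' i u hu)
    rwa [add_assoc] at h1
  · rw [hlift, LinearMap.sub_apply, hact]
    have : single g.left 1 * mapAut k (φ g.right) u - (1 : Module.End k (MonoidAlgebra k A)) u =
        (single g.left 1 - 1) * mapAut k (φ g.right) u + (mapAut k (φ g.right) u - u) := by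
      rw [sub_mul, one_mul, Module.End.one_apply]; abel
    rw [this]
    refine add_mem ?_ (mapAut_sub_mem (hφ _) i hu)
    rw [Ideal.IsTwoSided.pow_succ]
    exact Ideal.mul_mem_mul (single_sub_one_mem_augIdeal _) (mapAut_mem_augIdeal_pow _ hu)

/-- Some power of each automorphism of a finitely generated group acts trivially modulo `ω²`, over
a finite field: it acts on the finite ring `k[A] / ω²`. -/
theorem exists_pow_mem_unipotentAut {A : Type*} [Group A] [Group.FG A] [Finite k] (σ : MulAut A) :
    ∃ e, 0 < e ∧ σ ^ e ∈ unipotentAut k A := by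
  let Q := MonoidAlgebra k A ⧸ augIdeal k A ^ 2
  have : Module.Finite k Q := finite_quotient_augIdeal_pow 2
  have : Finite Q := Module.finite_of_finite k
  let f : ℕ → Q → Q := fun j x => Ideal.Quotient.mk _ (mapAut k (σ ^ j) (Quotient.out x))
  have hf : ∀ j v, f j (Ideal.Quotient.mk _ v) = Ideal.Quotient.mk _ (mapAut k (σ ^ j) v) := by
    intro j v
    rw [Ideal.Quotient.mk_eq_mk_iff_sub_mem, ← map_sub]
    refine mapAut_mem_augIdeal_pow _ ?_
    rw [← Ideal.Quotient.mk_eq_mk_iff_sub_mem]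
    exact Quotient.out_eq _
  obtain ⟨i, j, hne, hij⟩ := Finite.exists_ne_map_eq_of_infinite f
  wlog hlt : i < j generalizing i j
  · exact this j i hne.symm hij.symm (by omega)
  refine ⟨j - i, by omega, fun v => ?_⟩
  have h1 := congrFun hij (Ideal.Quotient.mk _ v)
  rw [hf, hf, eq_comm, Ideal.Quotient.mk_eq_mk_iff_sub_mem] at h1
  have h2 := mapAut_mem_augIdeal_pow (σ ^ i)⁻¹ h1
  rw [map_sub, ← AlgEquiv.mul_apply, ← AlgEquiv.mul_apply, ← map_mul, ← map_mul,
    inv_mul_cancel, map_one, AlgEquiv.one_apply] at h2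
  rwa [show (σ ^ i)⁻¹ * σ ^ j = σ ^ (j - i) by
    rw [inv_mul_eq_iff_eq_mul, ← pow_add]; congr 1; omega] at h2

end MonoidAlgebra

/-! ### Polycyclic-by-finite groups -/

theorem Group.fg_of_fg_quotient {G : Type*} [Group G] (K : Subgroup G) [K.Normal]
    (hK : Group.FG K) (hQ : Group.FG (G ⧸ K)) : Group.FG G := by
  classical
  obtain ⟨S, hS⟩ := (Group.fg_iff_subgroup_fg K).1 hK
  obtain ⟨T, hT⟩ := Group.fg_def.1 hQ
  refine Group.fg_def.2 ⟨S ∪ T.image Quotient.out, ?_⟩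
  set C := Subgroup.closure ((S ∪ T.image Quotient.out : Finset G) : Set G) with hC
  have hKC : K ≤ C := by
    rw [← hS]
    exact Subgroup.closure_mono (by simp)
  have hmap : C.map (QuotientGroup.mk' K) = ⊤ := by
    rw [eq_top_iff, ← hT, Subgroup.closure_le]
    intro t ht
    refine ⟨t.out, Subgroup.subset_closure ?_, Quotient.out_eq _⟩
    exact Finset.mem_union_right _ (Finset.mem_image_of_mem _ ht)
  have := Subgroup.comap_map_eq (QuotientGroup.mk' K) C
  rw [hmap, Subgroup.comap_top, QuotientGroup.ker_mk', sup_eq_left.2 hKC] at this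
  exact this.symm

theorem Group.finite_monoidHom {G H : Type*} [Group G] [hG : Group.FG G] [Group H] [Finite H] :
    Finite (G →* H) := by
  obtain ⟨S, hS⟩ := Group.fg_def.1 hG
  refine Finite.of_injective (fun (f : G →* H) (s : S) => f s) fun f g h => ?_
  exact MonoidHom.eq_of_eqOn_dense hS fun s hs => congrFun h ⟨s, hs⟩

/-- In a finitely generated group, every subgroup of finite index contains a characteristic one. -/
theorem Subgroup.exists_characteristic_le {G : Type*} [Group G] [Group.FG G] (N : Subgroup G)
    [N.FiniteIndex] : ∃ M ≤ N, M.FiniteIndex ∧ M.Characteristic := by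
  have : Finite (G →* Equiv.Perm (G ⧸ N)) := Group.finite_monoidHom
  refine ⟨⨅ f : G →* Equiv.Perm (G ⧸ N), f.ker, ?_, ?_, ?_⟩
  · refine (iInf_le _ (MulAction.toPermHom G (G ⧸ N))).trans ?_
    rw [← Subgroup.normalCore_eq_ker]
    exact N.normalCore_le
  · exact Subgroup.finiteIndex_iInf fun f => Subgroup.finiteIndex_ker f
  · rw [Subgroup.characteristic_iff_le_comap]
    intro φ x hx
    rw [Subgroup.mem_comap, Subgroup.mem_iInf]
    intro f
    exact Subgroup.mem_iInf.1 hx (f.comp φ.toMonoidHom)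

namespace MonoidAlgebra

/-- `G` is finitely generated and has a subgroup of finite index whose dimension subgroups over `k`
intersect trivially. -/
def IsVirtuallyResidual (k G : Type*) [Field k] [Group G] : Prop :=
  Group.FG G ∧ ∃ N : Subgroup G, N.FiniteIndex ∧ HasTrivialDimensionSubgroup k N

variable {k : Type*} [Field k]

theorem IsVirtuallyResidual.of_mulEquiv {G H : Type*} [Group G] [Group H]
    (hG : IsVirtuallyResidual k G) (e : G ≃* H) : IsVirtuallyResidual k H := by
  obtain ⟨hfg, N, hN, hres⟩ := hG
  refine ⟨Group.fg_of_surjective (f := e.toMonoidHom) e.surjective, N.map e.toMonoidHom, ?_, ?_⟩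
  · rw [Subgroup.finiteIndex_iff]
    exact (Subgroup.index_map_equiv N e).symm ▸ hN.index_ne_zero
  · exact hres.of_injective (N.equivMapOfInjective e.toMonoidHom e.injective).symm.toMonoidHom
      (MulEquiv.injective _)

theorem IsVirtuallyResidual.of_finite_quotient {G : Type*} [Group G] (K : Subgroup G) [K.Normal]
    (hK : IsVirtuallyResidual k K) [Finite (G ⧸ K)] : IsVirtuallyResidual k G := by
  obtain ⟨hfg, N, hN, hres⟩ := hK
  refine ⟨Group.fg_of_fg_quotient K hfg inferInstance, N.map K.subtype, ?_, ?_⟩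
  · have : K.FiniteIndex := Subgroup.finiteIndex_of_finite_quotient
    rw [Subgroup.finiteIndex_iff, Subgroup.index_map_subtype]
    exact mul_ne_zero hN.index_ne_zero this.index_ne_zero
  · exact hres.of_injective
      (N.equivMapOfInjective K.subtype K.subtype_injective).symm.toMonoidHom (MulEquiv.injective _)

/-- If `G / K` is infinite cyclic, generated by the image of `x`, and `A` is a suitable subgroup of
finite index in `K`, characteristic in `K`, then a power `y` of `x` acts unipotently on `A`; the
subgroup `A ⟨y⟩` is a semidirect product and has finite index in `G`. -/
theorem IsVirtuallyResidual.of_cyclic_quotient [Finite k] {G : Type*} [Group G] (K : Subgroup G)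
    [K.Normal] (hK : IsVirtuallyResidual k K) [hcyc : IsCyclic (G ⧸ K)] :
    IsVirtuallyResidual k G := by
  by_cases hfin : Finite (G ⧸ K)
  · exact .of_finite_quotient K hK
  rw [not_finite_iff_infinite] at hfin
  obtain ⟨hfg, N, hN, hres⟩ := hK
  obtain ⟨x', hx'⟩ := hcyc.exists_generator
  obtain ⟨x, rfl⟩ := QuotientGroup.mk_surjective x'
  have hQ : Group.FG (G ⧸ K) := Group.fg_def.2 ⟨{(x : G ⧸ K)}, by
    rw [eq_top_iff]
    intro z _
    rw [Finset.coe_singleton, ← Subgroup.zpowers_eq_closure]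
    exact hx' z⟩
  refine ⟨Group.fg_of_fg_quotient K hfg hQ, ?_⟩
  have hxK : ∀ s : ℤ, x ^ s ∈ K → s = 0 := by
    intro s hs
    rw [← QuotientGroup.eq_one_iff, QuotientGroup.mk_zpow] at hs
    by_contra hs0
    have hord : orderOf (x : G ⧸ K) = 0 := Infinite.orderOf_eq_zero_of_forall_mem_zpowers hx'
    rw [orderOf_eq_zero_iff] at hord
    exact hord (isOfFinOrder_iff_zpow_eq_one.2 ⟨s, hs0, hs⟩)
  obtain ⟨M, hMN, hM, hMc⟩ := N.exists_characteristic_le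
  have hMfg : Group.FG M := Subgroup.fg_of_index_ne_zero M
  let A : Subgroup G := M.map K.subtype
  have hAK : A ≤ K := Subgroup.map_subtype_le M
  let e : M ≃* A := M.equivMapOfInjective K.subtype K.subtype_injective
  have hAn : A.Normal := ConjAct.normal_of_characteristic_of_normal
  have hAfg : Group.FG A := Group.fg_of_surjective (f := e.toMonoidHom) e.surjective
  have hAres : HasTrivialDimensionSubgroup k A :=
    hres.of_injective ((Subgroup.inclusion hMN).comp e.symm.toMonoidHom)
      ((Subgroup.inclusion_injective hMN).comp e.symm.injective)
  obtain ⟨r, hr, hru⟩ := exists_pow_mem_unipotentAut (k := k) (MulAut.conjNormal x : MulAut A)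
  let y := x ^ r
  let φ : Multiplicative ℤ →* MulAut A := zpowersHom _ ((MulAut.conjNormal x : MulAut A) ^ r)
  have hφ : ∀ c, φ c ∈ unipotentAut k A := fun c => Subgroup.zpow_mem _ hru _
  have hφ' : ∀ c, φ c = MulAut.conjNormal (y ^ c.toAdd) := fun c => by
    rw [map_zpow, map_pow]; rfl
  let Φ : A ⋊[φ] Multiplicative ℤ →* G :=
    SemidirectProduct.lift A.subtype (zpowersHom G y) fun c => by
      ext a
      have h1 : zpowersHom G y c = y ^ c.toAdd := rfl
      change ((φ c a : A) : G) = zpowersHom G y c * a * (zpowersHom G y c)⁻¹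
      rw [hφ', h1, MulAut.conjNormal_apply]
  have hΦ : ∀ g, Φ g = g.left * y ^ g.right.toAdd := fun g => by
    simp [Φ, SemidirectProduct.lift]
  have hinj : Function.Injective Φ := by
    rw [injective_iff_map_eq_one]
    intro g hg
    rw [hΦ] at hg
    have h1 : y ^ g.right.toAdd ∈ K := by
      rw [← inv_mul_eq_iff_eq_mul.2 hg.symm, mul_one]
      exact inv_mem (hAK g.left.2)
    rw [show y ^ g.right.toAdd = x ^ ((r : ℤ) * g.right.toAdd) by
      rw [zpow_mul, zpow_natCast]] at h1
    have h2 : g.right.toAdd = 0 := by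
      have := hxK _ h1
      rcases mul_eq_zero.1 this with h | h
      · omega
      · exact h
    rw [h2, zpow_zero, mul_one] at hg
    exact SemidirectProduct.ext (Subtype.ext hg) h2
  refine ⟨Φ.range, ?_, ?_⟩
  swap
  · exact (hAres.semidirectProduct hasTrivialDimensionSubgroup_int φ hφ).of_injective
      (MonoidHom.ofInjective hinj).symm.toMonoidHom (MulEquiv.injective _)
  -- Every coset of `A ⟨y⟩` contains some `x ^ j * t` with `0 ≤ j < r` and `t` from a transversal of
  -- `A` in `K`.
  have hAB : ∀ a ∈ A, a ∈ Φ.range := fun a ha => ⟨⟨⟨a, ha⟩, 1⟩, by simp [hΦ]⟩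
  have hyB : ∀ n : ℤ, y ^ n ∈ Φ.range := fun n => ⟨⟨1, Multiplicative.ofAdd n⟩, by simp [hΦ]⟩
  let f : Fin r × (K ⧸ M) → G ⧸ Φ.range := fun p => (x ^ (p.1 : ℕ) * (p.2.out : K) : G)
  have hf : Function.Surjective f := by
    intro g'
    obtain ⟨g, rfl⟩ := QuotientGroup.mk_surjective g'
    obtain ⟨n, hn⟩ := Subgroup.mem_zpowers_iff.1 (hx' (g : G ⧸ K))
    rw [← QuotientGroup.mk_zpow, QuotientGroup.eq] at hn
    have hr' : (r : ℤ) ≠ 0 := by omega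
    obtain ⟨j, hj⟩ := Int.eq_ofNat_of_zero_le (Int.emod_nonneg n hr')
    have hjr : j < r := by
      have := Int.emod_lt_of_pos n (by omega : (0 : ℤ) < r)
      omega
    have hxn : x ^ n = x ^ j * y ^ (n / r) := by
      rw [← zpow_natCast x j, show y = x ^ (r : ℤ) from (zpow_natCast x r).symm, ← zpow_mul,
        ← zpow_add]
      congr 1
      have := Int.emod_add_mul_ediv n r
      omega
    set m := n / r
    let c : K := ⟨y ^ m * ((x ^ n)⁻¹ * g) * (y ^ m)⁻¹, ‹K.Normal›.conj_mem _ hn _⟩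
    refine ⟨(⟨j, hjr⟩, (c : K ⧸ M)), ?_⟩
    have hc : (c : K ⧸ M).out⁻¹ * c ∈ M := by
      rw [← QuotientGroup.eq]; exact Quotient.out_eq _
    have hc' : ((c : K ⧸ M).out : G)⁻¹ * c ∈ A := ⟨_, hc, rfl⟩
    simp only [f]
    rw [QuotientGroup.eq]
    have : (x ^ j * ((c : K ⧸ M).out : G))⁻¹ * g = ((c : K ⧸ M).out : G)⁻¹ * c * y ^ m := by
      simp only [c, hxn]
      group
    rw [this]
    exact mul_mem (hAB _ hc') (hyB m)
  have : Finite (G ⧸ Φ.range) := Finite.of_surjective f hf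
  exact Subgroup.finiteIndex_of_finite_quotient

/-- Over a finite field of characteristic `q`, this says that polycyclic-by-finite groups are virtually
residually finite `q`-groups. -/
theorem _root_.IsPolycyclicByFinite.isVirtuallyResidual [Finite k] {G : Type*} [Group G]
    (hG : IsPolycyclicByFinite G) : IsVirtuallyResidual k G := by
  obtain ⟨n, H, h0, hn, hstep⟩ := hG
  have key : ∀ i ≤ n, IsVirtuallyResidual k (H i) := by
    intro i
    induction i with
    | zero =>
      intro _
      rw [h0]
      exact ⟨inferInstance, ⊤, inferInstance, fun g hg => absurd (Subsingleton.elim _ _) hg⟩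
    | succ i ih =>
      intro hi
      obtain ⟨hle, hnorm, hor⟩ := hstep i hi
      have hK := (ih (by omega)).of_mulEquiv (Subgroup.subgroupOfEquivOfLe hle).symm
      rcases hor with hcyc | hfin
      · exact .of_cyclic_quotient _ hK
      · exact .of_finite_quotient _ hK
  have := key n le_rfl
  rw [hn] at this
  exact this.of_mulEquiv Subgroup.topEquiv

end MonoidAlgebra

/-! ### Finite quotients of order prime to the characteristic -/

namespace MonoidAlgebra

/-- The `n`-th dimension subgroup `{g | g - 1 ∈ ωⁿ}` of `G` over `k`. -/
noncomputable def dimensionSubgroup (k G : Type*) [Field k] [Group G] (n : ℕ) : Subgroup G :=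
  ((Ideal.Quotient.mk (augIdeal k G ^ n)).toMonoidHom.comp (of k G)).toHomUnits.ker

section DimensionSubgroup

variable {k G : Type*} [Field k] [Group G]

theorem mem_dimensionSubgroup {n : ℕ} {g : G} :
    g ∈ dimensionSubgroup k G n ↔ single g 1 - 1 ∈ augIdeal k G ^ n := by
  rw [← Ideal.Quotient.mk_eq_mk_iff_sub_mem, map_one, dimensionSubgroup, MonoidHom.mem_ker,
    Units.ext_iff]
  rfl

theorem dimensionSubgroup_antitone : Antitone (dimensionSubgroup k G) := fun m n hmn g hg => by
  rw [mem_dimensionSubgroup] at hg ⊢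
  exact Ideal.pow_le_pow_right hmn hg

instance (n : ℕ) : (dimensionSubgroup k G n).Characteristic := by
  rw [Subgroup.characteristic_iff_le_comap]
  intro φ g hg
  rw [Subgroup.mem_comap]
  rw [mem_dimensionSubgroup] at hg ⊢
  have := mapDomain_mem_augIdeal_pow φ.toMonoidHom n hg
  rwa [map_sub, map_one, mapDomainAlgHom_apply, mapDomain_single] at this

theorem finiteIndex_dimensionSubgroup [Finite k] [Group.FG G] (n : ℕ) :
    (dimensionSubgroup k G n).FiniteIndex := by
  have : Module.Finite k (MonoidAlgebra k G ⧸ augIdeal k G ^ n) := finite_quotient_augIdeal_pow n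
  have hQ : Finite (MonoidAlgebra k G ⧸ augIdeal k G ^ n) := Module.finite_of_finite k
  exact Subgroup.finiteIndex_ker _

theorem exists_index_dimensionSubgroup_eq_pow (q : ℕ) [Fact q.Prime] [CharP k q] [Finite k]
    [Group.FG G] (n : ℕ) : ∃ c, (dimensionSubgroup k G n).index = q ^ c := by
  have := finiteIndex_dimensionSubgroup (k := k) (G := G) n
  refine IsPGroup.iff_card.1 fun x => ?_
  obtain ⟨g, rfl⟩ := QuotientGroup.mk_surjective x
  refine ⟨n, ?_⟩
  have hle : n ≤ q ^ n := (Nat.lt_pow_self (Fact.out : q.Prime).one_lt).le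
  rw [← QuotientGroup.mk_pow, QuotientGroup.eq_one_iff, mem_dimensionSubgroup]
  have : CharP (MonoidAlgebra k G) q := charP_of_injective_algebraMap (algebraMap k _).injective q
  have h1 : (single (g ^ q ^ n) 1 : MonoidAlgebra k G) - 1 = (single g 1 - 1) ^ q ^ n := by
    rw [sub_pow_char_pow_of_commute q n (Commute.one_right _), single_pow, one_pow, one_pow]
  rw [h1]
  refine Ideal.pow_le_pow_right hle (Ideal.pow_mem_pow (single_sub_one_mem_augIdeal g) _)

end DimensionSubgroup

/-- The terms of the chain are the dimension subgroups of `N` over `𝔽_q`, which are characteristic in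
`N`, hence normal in `G`. -/
theorem _root_.IsPolycyclicByFinite.exists_residual_chain {G : Type*} [Group G]
    (hG : IsPolycyclicByFinite G) (q : ℕ) [Fact q.Prime] :
    ∃ (N : Subgroup G) (M : ℕ → Subgroup G), N.Normal ∧ N.FiniteIndex ∧ Antitone M ∧
      (∀ n, (M n).Normal ∧ M n ≤ N ∧ (M n).FiniteIndex ∧ ∃ c, (M n).relIndex N = q ^ c) ∧
      ∀ g ≠ 1, ∃ n, g ∉ M n := by
  obtain ⟨hfg, N', hN', hres'⟩ := hG.isVirtuallyResidual (k := ZMod q)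
  let N := N'.normalCore
  have hres : HasTrivialDimensionSubgroup (ZMod q) N :=
    hres'.of_injective (Subgroup.inclusion N'.normalCore_le) (Subgroup.inclusion_injective _)
  have hNfg : Group.FG N := Subgroup.fg_of_index_ne_zero N
  have hrel : ∀ n, (((dimensionSubgroup (ZMod q) N n).map N.subtype).relIndex N) =
      (dimensionSubgroup (ZMod q) N n).index := fun n => by
    rw [Subgroup.relIndex, Subgroup.subgroupOf,
      Subgroup.comap_map_eq_self_of_injective N.subtype_injective]
  refine ⟨N, fun n => (dimensionSubgroup (ZMod q) N n).map N.subtype, inferInstance, inferInstance,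
    fun m n h => Subgroup.map_mono (dimensionSubgroup_antitone h), fun n =>
      ⟨ConjAct.normal_of_characteristic_of_normal, Subgroup.map_subtype_le _, ?_, ?_⟩, ?_⟩
  · have := finiteIndex_dimensionSubgroup (k := ZMod q) (G := N) n
    rw [Subgroup.finiteIndex_iff, Subgroup.index_map_subtype]
    exact mul_ne_zero this.index_ne_zero (Subgroup.FiniteIndex.index_ne_zero (H := N))
  · rw [hrel]
    exact exists_index_dimensionSubgroup_eq_pow q n
  · intro g hg
    by_cases hgN : g ∈ N
    · obtain ⟨n, hn⟩ := hres ⟨g, hgN⟩ fun h => hg (congrArg Subtype.val h)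
      refine ⟨n, ?_⟩
      rintro ⟨x, hx, rfl⟩
      exact hn (mem_dimensionSubgroup.1 hx)
    · exact ⟨0, fun h => hgN (Subgroup.map_subtype_le _ h)⟩

/-! ### The intersection of the cofinite maximal ideals -/

variable {k G : Type*} [Field k] [Group G]

theorem eq_zero_of_forall_mapDomain_eq_zero (M : ℕ → Subgroup G) (hM : Antitone M)
    [hMn : ∀ n, (M n).Normal] (h1 : ∀ g ≠ 1, ∃ n, g ∉ M n) {a : MonoidAlgebra k G}
    (h : ∀ n, mapDomainAlgHom k k (QuotientGroup.mk' (M n)) a = 0) : a = 0 := by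
  classical
  choose! ν hν using h1
  -- A term of the chain that separates the elements of the support of `a`.
  let n := (a.coeff.support ×ˢ a.coeff.support).sup fun p => ν (p.1⁻¹ * p.2)
  have hinj : Set.InjOn (QuotientGroup.mk' (M n)) (a.coeff.support : Set G) := by
    intro x hx y hy hxy
    by_contra hne
    refine hν (x⁻¹ * y) (fun h => hne (inv_mul_eq_one.1 h)) (hM ?_ (QuotientGroup.eq.1 hxy))
    exact Finset.le_sup (f := fun p : G × G => ν (p.1⁻¹ * p.2)) (b := (x, y))
      (Finset.mem_product.2 ⟨hx, hy⟩)
  ext g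
  by_contra hg
  have hgs : g ∈ a.coeff.support := Finsupp.mem_support_iff.2 hg
  have h2 := congrArg (fun u => u.coeff (QuotientGroup.mk' (M n) g)) (h n)
  have h3 : (a.coeff.mapDomain (QuotientGroup.mk' (M n))) (QuotientGroup.mk' (M n) g) =
      a.coeff g := Finsupp.mapDomain_apply' _ _ subset_rfl hinj hgs
  exact hg (h3.symm.trans h2)

theorem mapDomainAlgHom_surjective {H : Type*} [Group H] (φ : G →* H)
    (hφ : Function.Surjective φ) : Function.Surjective (mapDomainAlgHom k k φ) := by
  intro y
  induction y using induction_linear with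
  | zero => exact ⟨0, map_zero _⟩
  | add x y hx hy =>
    obtain ⟨x, rfl⟩ := hx
    obtain ⟨y, rfl⟩ := hy
    exact ⟨x + y, map_add _ _ _⟩
  | single h c =>
    obtain ⟨g, rfl⟩ := hφ h
    exact ⟨single g c, by simp⟩

/-- For `M ≤ N` normal subgroups of finite index in `G`, with `[N : M] ≠ 0` in `k`, the radical of
`k[G / M]` is nilpotent of index at most `[G : N]`, a bound that does not depend on `M`. -/
theorem jacobson_quotient_pow_eq_bot (N M : Subgroup G) [N.Normal] [M.Normal] [M.FiniteIndex]
    (hMN : M ≤ N) (hrel : (M.relIndex N : k) ≠ 0) :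
    Ring.jacobson (MonoidAlgebra k (G ⧸ M)) ^ N.index = ⊥ := by
  let L := N.map (QuotientGroup.mk' M)
  have hL : L.Normal := Subgroup.Normal.map inferInstance _ (QuotientGroup.mk'_surjective M)
  have hidx : L.index = N.index := by
    refine Subgroup.index_map_eq N (QuotientGroup.mk'_surjective M) ?_
    rwa [QuotientGroup.ker_mk']
  have hN0 : N.index ≠ 0 := (Subgroup.finiteIndex_of_le hMN).index_ne_zero
  have hcard : Nat.card L = M.relIndex N := by
    have h1 : Nat.card L * L.index = Nat.card (G ⧸ M) := L.card_mul_index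
    have h2 : M.relIndex N * N.index = M.index := Subgroup.relIndex_mul_index hMN
    rw [hidx] at h1
    exact Nat.eq_of_mul_eq_mul_right (Nat.pos_of_ne_zero hN0) (h1.trans h2.symm)
  rw [← hidx]
  exact jacobson_pow_index_eq_bot L (by rwa [hcard])

/-- The elements of `k[G]` that lie in all ideals with simple quotient of finite dimension vanish. -/
theorem eq_zero_of_forall_mem (hG : IsPolycyclicByFinite G)
    (hΔ : ∀ p : ℕ, 0 < p → CharP k p → ∀ g ∈ fcSubgroup G, orderOf g ≠ p) {b : MonoidAlgebra k G}
    (hb : ∀ P : TwoSidedIdeal (MonoidAlgebra k G), IsSimpleRing P.ringCon.Quotient →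
      FiniteDimensional k P.ringCon.Quotient → b ∈ P) : b = 0 := by
  have hjac : ∀ (M : Subgroup G) [M.Normal] [M.FiniteIndex],
      mapDomainAlgHom k k (QuotientGroup.mk' M) b ∈ Ring.jacobson (MonoidAlgebra k (G ⧸ M)) := by
    intro M _ _
    have : Module.Finite k (MonoidAlgebra k (G ⧸ M)) :=
      Module.Finite.equiv (coeffLinearEquiv k : _ ≃ₗ[k] (G ⧸ M) →₀ k).symm
    exact map_mem_jacobson_of_forall_mem _
      (mapDomainAlgHom_surjective _ (QuotientGroup.mk'_surjective M)) hb
  obtain ⟨p, hp⟩ := CharP.exists k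
  rcases CharP.char_is_prime_or_zero k p with hprime | rfl
  · -- In characteristic `p`, use a chain with quotients of `q`-power order for a prime `q ≠ p`.
    obtain ⟨q, hq, hqp⟩ : ∃ q : ℕ, q.Prime ∧ q ≠ p := by
      by_cases h2 : p = 2
      · exact ⟨3, Nat.prime_three, by omega⟩
      · exact ⟨2, Nat.prime_two, fun h => h2 h.symm⟩
    have : Fact p.Prime := ⟨hprime⟩
    have : Fact q.Prime := ⟨hq⟩
    obtain ⟨N, M, hN, hNf, hM, hMn, hM1⟩ := hG.exists_residual_chain q
    have hMnorm : ∀ n, (M n).Normal := fun n => (hMn n).1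
    have hMfin : ∀ n, (M n).FiniteIndex := fun n => (hMn n).2.2.1
    have hbot : ∀ n, Ring.jacobson (MonoidAlgebra k (G ⧸ M n)) ^ N.index = ⊥ := by
      intro n
      obtain ⟨-, hle, -, c, hc⟩ := hMn n
      refine jacobson_quotient_pow_eq_bot N (M n) hle ?_
      rw [hc, Nat.cast_pow]
      refine pow_ne_zero _ fun h0 => hqp ?_
      rw [CharP.cast_eq_zero_iff k p] at h0
      exact ((Nat.prime_dvd_prime_iff_eq hprime hq).1 h0).symm
    by_contra hb0
    -- By semiprimeness, a non-zero element in all the radicals yields non-zero elements in their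
    -- higher powers.
    have hpow : ∀ j, ∃ a : MonoidAlgebra k G, a ≠ 0 ∧ ∀ n,
        mapDomainAlgHom k k (QuotientGroup.mk' (M n)) a ∈
          Ring.jacobson (MonoidAlgebra k (G ⧸ M n)) ^ (j + 1) := by
      intro j
      induction j with
      | zero => exact ⟨b, hb0, fun n => by rw [zero_add, Submodule.pow_one]; exact hjac (M n)⟩
      | succ j ih =>
        obtain ⟨a, ha0, ha⟩ := ih
        obtain ⟨x, hx⟩ : ∃ x, a * x * a ≠ 0 := by
          by_contra! h
          exact ha0 (eq_zero_of_forall_mul_mul_eq_zero p (hΔ p hprime.pos hp) h)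
        refine ⟨a * x * a, hx, fun n => ?_⟩
        rw [map_mul, map_mul, mul_assoc]
        refine Ideal.pow_le_pow_right (by omega : j + 1 + 1 ≤ (j + 1) + (j + 1)) ?_
        rw [Ideal.IsTwoSided.pow_add]
        exact Ideal.mul_mem_mul (ha n) (Ideal.mul_mem_left _ _ (ha n))
    obtain ⟨a, ha0, ha⟩ := hpow N.index
    refine ha0 (eq_zero_of_forall_mapDomain_eq_zero M hM hM1 fun n => ?_)
    have := Ideal.pow_le_pow_right (Nat.le_succ _) (ha n)
    rwa [hbot, Ideal.mem_bot] at this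
  · -- In characteristic zero, all quotients of a residual chain have semisimple group algebras.
    have : Fact (Nat.Prime 2) := ⟨Nat.prime_two⟩
    have : CharZero k := CharP.charP_to_charZero k
    obtain ⟨N, M, hN, hNf, hM, hMn, hM1⟩ := hG.exists_residual_chain 2
    have hMnorm : ∀ n, (M n).Normal := fun n => (hMn n).1
    refine eq_zero_of_forall_mapDomain_eq_zero M hM hM1 fun n => ?_
    have hfin : (M n).FiniteIndex := (hMn n).2.2.1
    have h1 := jacobson_quotient_pow_eq_bot (k := k) ⊤ (M n) le_top (by
      rw [Subgroup.relIndex_top_right]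
      exact Nat.cast_ne_zero.2 hfin.index_ne_zero)
    rw [Subgroup.index_top, Submodule.pow_one] at h1
    have := hjac (M n)
    rwa [h1, Ideal.mem_bot] at this

end MonoidAlgebra

theorem mainTheorem10 (k : Type*) [Field k] (G : Type*) [Group G]
    (hG : IsPolycyclicByFinite G)
    (hΔ : ∀ p : ℕ, 0 < p → CharP k p → ∀ g ∈ fcSubgroup G, orderOf g ≠ p) :
    IsResiduallySimpleArtinian (MonoidAlgebra k G) ∧
      sInf {P : TwoSidedIdeal (MonoidAlgebra k G) |
        IsCoatom P ∧ FiniteDimensional k P.ringCon.Quotient} = ⊥ := by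
  refine ⟨?_, ?_⟩
  · rw [IsResiduallySimpleArtinian, eq_bot_iff]
    intro b hb
    rw [TwoSidedIdeal.mem_sInf] at hb
    refine (TwoSidedIdeal.mem_bot _).2 (MonoidAlgebra.eq_zero_of_forall_mem hG hΔ fun P hs hf => ?_)
    exact hb P ⟨hs, isArtinian_of_tower k inferInstance⟩
  · rw [eq_bot_iff]
    intro b hb
    rw [TwoSidedIdeal.mem_sInf] at hb
    refine (TwoSidedIdeal.mem_bot _).2 (MonoidAlgebra.eq_zero_of_forall_mem hG hΔ fun P hs hf => ?_)
    exact hb P ⟨P.isCoatom_of_isSimpleRing_quotient, hf⟩
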